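/- Corollary 1.7. An IP-set is a set of integers of the form $$FS(\{n_i\}_{i=1}^\infty)=\Big\{\sum_{i\in\alpha} n_i : \alpha\subset\mathbb N \text{ finite and non-empty}\Big\},$$ where $\{n_i\}_{i=1}^\infty$ is a sequence of (not necessarily distinct) integers, infinitely many of which are non-zero; an IP$^*$-set is a set of integers that meets every IP-set. A homeomorphism $T$ of a compact metric space $X$ is called minimal if every orbit $\{T^nx : n\in\mathbb Z\}$ is dense in $X$; a minimal $T$ is called topologically mildly mixing if for all non-empty open $U,V\subseteq X$ the set $\{n\in\mathbb Z : U\cap T^{-n}V\neq\emptyset\}$ is an IP$^*$-set. An integral polynomial is a polynomial taking integer values at the integers. Let $X$ be a compact metric space and let $\Gamma$ be an abelian group acting on $X$ by homeomorphisms such that every $\Gamma$-orbit is dense in $X$, and such that every $T\in\Gamma$ with $T\neq e_\Gamma$ acts on $X$ as a minimal and topologically mildly mixing homeomorphism. Let $d,k\in\mathbb N$, let $T_1,\dots,T_d\in\Gamma$, and let $p_{i,j}$ ($1\le i\le k$, $1\le j\le d$) be integral polynomials such that each of the maps $$g_i(n)=T_1^{p_{i,1}(n)}\cdots T_d^{p_{i,d}(n)}\quad(1\le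 i\le k)$$ and each of the maps $$g_i(n)g_j(n)^{-1}=T_1^{p_{i,1}(n)-p_{j,1}(n)}\cdots T_d^{p_{i,d}(n)-p_{j,d}(n)}\quad(1\le i\neq j\le k)$$ is a nonconstant map from $\mathbb Z$ to $\Gamma$. Then for every IP-set $A$ there is a dense $G_\delta$ subset $X_0$ of $X$ such that for every $x\in X_0$ the set $$\{(g_1(n)x,\dots,g_k(n)x) : n\in A\}$$ is dense in $X^k$. -/

import Mathlib

/-- `IPMild.FS s` is the set of all sums `∑ i ∈ α, s i`, where `α` runs over the non-empty finite
sets of indices. -/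
def IPMild.FS (s : ℕ → ℤ) : Set ℤ :=
  {m | ∃ α : Finset ℕ, α.Nonempty ∧ m = ∑ i ∈ α, s i}

/-- IP-sets of integers: the sets `FS s`, where repetitions and zeros among the generators `s i` are
allowed. Only the degenerate case of finitely many non-zero generators is left out: it is the case
in which `FS s` is a finite set, such as `{0}`. -/
def IPMild.IsIPSet (A : Set ℤ) : Prop :=
  ∃ s : ℕ → ℤ, {i | s i ≠ 0}.Infinite ∧ A = IPMild.FS s

/-- An IP*-set is a set of integers that meets every IP-set. -/
def IPMild.IsIPStarSet (B : Set ℤ) : Prop :=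
  ∀ A : Set ℤ, IPMild.IsIPSet A → (B ∩ A).Nonempty

/-- The element `t` acts on `X` as a topologically mildly mixing transformation: for all non-empty
open `U`, `V`, the set `N(U, V)` of all integers `n` with `U ∩ t⁻ⁿ V ≠ ∅` is an IP*-set. -/
def IPMild.IsTopMildlyMixing {Γ : Type*} [Group Γ] (X : Type*) [TopologicalSpace X]
    [MulAction Γ X] (t : Γ) : Prop :=
  ∀ U V : Set X, IsOpen U → U.Nonempty → IsOpen V → V.Nonempty →
    IPMild.IsIPStarSet {n : ℤ | (U ∩ (fun x : X => t ^ n • x) ⁻¹' V).Nonempty}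

/-- The system `(X, t)`, that is, the action on `X` of the cyclic group generated by `t`,
is minimal and topologically mildly mixing. -/
def IPMild.IsMildlyMixingMinimal {Γ : Type*} [Group Γ] (X : Type*) [TopologicalSpace X]
    [MulAction Γ X] (t : Γ) : Prop :=
  MulAction.IsMinimal (Subgroup.zpowers t) X ∧ IPMild.IsTopMildlyMixing X t

/-- Integral polynomials, as functions on the integers: the integer-valued functions on `ℤ` that are
given by a polynomial (with rational coefficients, as is automatic for integer values). -/
def IPMild.IsIntegralPolynomial (f : ℤ → ℤ) : Prop :=
  ∃ P : Polynomial ℚ, ∀ n : ℤ, P.eval (n : ℚ) = (f n : ℚ)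

/-- The expression `T₁ ^ q₁(n) ⋯ T_d ^ q_d(n)`. -/
def IPMild.polyExpr {Γ : Type*} [CommGroup Γ] {d : ℕ} (T : Fin d → Γ) (q : Fin d → ℤ → ℤ)
    (n : ℤ) : Γ :=
  ∏ j, T j ^ q j n

/-- `g` depends nontrivially on `n`: it is a nonconstant map from `ℤ` to `Γ`. -/
def IPMild.DependsNontrivially {Γ : Type*} (g : ℤ → Γ) : Prop :=
  ∃ m n : ℤ, g m ≠ g n

/-! By Baire category it suffices that, for non-empty open `U` and `V i`, some `n ∈ A` and `x ∈ U`
satisfy `g i n • x ∈ V i` for all `i`. Hindman's theorem supplies an idempotent ultrafilter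
containing `A` and every IP*-set, so mild mixing becomes a statement about almost every `n`.

The transfer statement (`exists_mem_of_hasWeight`) is a PET induction. Minimality and compactness
give a finite `τ ⊆ Γ` such that every point is carried into `U` by some `t ∈ τ`. Choose shifts `m
t`, and let `φ` be a shift of a member of least degree. The quotients by `φ` of the maps `n ↦ g (n +
m t) / g (m t)` have smaller weight (`HasWeight.reduce`), so induction yields `n` and `y` with `g (n
+ m t) • t • y ∈ V g` for all `t ∈ τ` at once; a `t` with `t • y ∈ U` then gives the time `n + m t`.

Coinciding shifts must have compatible targets (`exists_translates`). A nonlinear map has distinct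
shifts because `Γ` is torsion-free; a linear map is its own shift, and there mild mixing makes the
targets intersect. -/

namespace IPMild

/-! ### Polynomial maps into an abelian group. -/

section PolynomialMaps

variable {Γ : Type*} [CommGroup Γ]

/-- The group of maps `ℤ → Γ` that are killed by taking `D` successive differences, that is, the
polynomial maps of degree less than `D`. -/
def polyMap : ℕ → Subgroup (ℤ → Γ)
  | 0 => ⊥
  | D + 1 =>
    { carrier := {g | ∀ m : ℤ, (fun n => g (n + m) / g n) ∈ polyMap D}
      one_mem' := fun m => by
        have : (fun n : ℤ => (1 : ℤ → Γ) (n + m) / (1 : ℤ → Γ) n) = 1 := by ext n; simp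
        rw [this]; exact one_mem _
      mul_mem' := fun {g h} hg hh m => by
        have : (fun n : ℤ => (g * h) (n + m) / (g * h) n) =
            (fun n => g (n + m) / g n) * (fun n => h (n + m) / h n) := by
          ext n; simp [mul_div_mul_comm]
        rw [this]; exact mul_mem (hg m) (hh m)
      inv_mem' := fun {g} hg m => by
        have : (fun n : ℤ => g⁻¹ (n + m) / g⁻¹ n) = (fun n => g (n + m) / g n)⁻¹ := by
          ext n; simp [div_eq_mul_inv, mul_comm]
        rw [this]; exact inv_mem (hg m) }

theorem mem_polyMap_zero {g : ℤ → Γ} : g ∈ polyMap 0 ↔ g = 1 := Subgroup.mem_bot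

theorem polyMap_le_succ (D : ℕ) : polyMap (Γ := Γ) D ≤ polyMap (D + 1) := by
  induction D with
  | zero => intro g hg; rw [mem_polyMap_zero.1 hg]; exact one_mem _
  | succ D ih => exact fun g hg m => ih (hg m)

theorem polyMap_mono : Monotone (polyMap (Γ := Γ)) := monotone_nat_of_le_succ polyMap_le_succ

theorem const_mem_polyMap {D : ℕ} (hD : 1 ≤ D) (c : Γ) : (fun _ : ℤ => c) ∈ polyMap D := by
  refine polyMap_mono hD ?_
  intro m
  rw [mem_polyMap_zero]
  ext n; simp

theorem shift_mem_polyMap {D : ℕ} {g : ℤ → Γ} (hg : g ∈ polyMap D) (a : ℤ) :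
    (fun n => g (n + a)) ∈ polyMap D := by
  induction D generalizing g with
  | zero =>
    rw [mem_polyMap_zero] at hg ⊢
    subst hg; rfl
  | succ D ih =>
    intro m
    have := ih (hg m)
    simpa only [add_right_comm] using this

theorem eq_of_mem_polyMap_one {g : ℤ → Γ} (hg : g ∈ polyMap 1) (n : ℤ) : g n = g 0 := by
  have h := congrFun (mem_polyMap_zero.1 (hg n)) 0
  simpa [div_eq_one] using h

/-- The translate of a map by `m`, normalized to have the value `1` at `0`. -/
def nshift (g : ℤ → Γ) (m : ℤ) : ℤ → Γ := fun n => g (n + m) / g m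

theorem nshift_zero (g : ℤ → Γ) (m : ℤ) : nshift g m 0 = 1 := by simp [nshift]

theorem nshift_div_mem {d : ℕ} (hd : 1 ≤ d) {g : ℤ → Γ} (hg : g ∈ polyMap (d + 1)) (m : ℤ) :
    nshift g m / g ∈ polyMap d := by
  have : nshift g m / g = (fun n => g (n + m) / g n) * (fun _ => (g m)⁻¹) := by
    ext n; simp [nshift, div_eq_mul_inv, mul_right_comm]
  rw [this]
  exact mul_mem (hg m) (const_mem_polyMap hd _)

theorem nshift_mem {d : ℕ} (hd : 1 ≤ d) {g : ℤ → Γ} (hg : g ∈ polyMap d) (m : ℤ) :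
    nshift g m ∈ polyMap d := by
  have : nshift g m = (fun n => g (n + m)) * (fun _ => (g m)⁻¹) := by
    ext n; simp [nshift, div_eq_mul_inv]
  rw [this]
  exact mul_mem (shift_mem_polyMap hg m) (const_mem_polyMap hd _)

theorem nshift_nshift {g : ℤ → Γ} (h0 : g 0 = 1) (m : ℤ) : nshift (nshift g m) (-m) = g := by
  ext n; simp [nshift, h0]

theorem mem_of_nshift_mem {d : ℕ} (hd : 1 ≤ d) {g : ℤ → Γ} (h0 : g 0 = 1) {m : ℤ}
    (hg : nshift g m ∈ polyMap d) : g ∈ polyMap d :=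
  nshift_nshift h0 m ▸ nshift_mem hd hg (-m)

theorem eq_zpow_of_forall_succ {g : ℤ → Γ} {c : Γ} (h : ∀ n, g (n + 1) = g n * c) (n : ℤ) :
    g n = g 0 * c ^ n := by
  induction n with
  | zero => simp
  | succ n ih => rw [h, ih, zpow_add_one, mul_assoc]
  | pred n ih =>
    have := h (-n - 1)
    rw [sub_add_cancel, ih] at this
    rw [zpow_sub_one, ← mul_assoc, this, mul_inv_cancel_right]

theorem exists_eq_zpow_of_mem_polyMap_two {g : ℤ → Γ} (hg : g ∈ polyMap 2) (h0 : g 0 = 1) :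
    ∃ c : Γ, ∀ n, g n = c ^ n := by
  refine ⟨g 1, fun n => ?_⟩
  rw [eq_zpow_of_forall_succ (g := g) (c := g 1) (fun n => ?_) n, h0, one_mul]
  have := eq_of_mem_polyMap_one (hg 1) n
  simp only [zero_add, h0, div_one] at this
  rw [← this, mul_div_cancel]

theorem nshift_eq_self {g : ℤ → Γ} (hg : g ∈ polyMap 2) (h0 : g 0 = 1) (m : ℤ) :
    nshift g m = g := by
  obtain ⟨c, hc⟩ := exists_eq_zpow_of_mem_polyMap_two hg h0
  ext n
  simp [nshift, hc, zpow_add]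

theorem mem_polyMap_two_of_forall_succ {g : ℤ → Γ} {c : Γ} (h : ∀ n, g (n + 1) = g n * c) :
    g ∈ polyMap 2 := by
  intro m
  have : (fun n => g (n + m) / g n) = fun _ => c ^ m := by
    ext n
    rw [eq_zpow_of_forall_succ h (n + m), eq_zpow_of_forall_succ h n, zpow_add, ← mul_assoc,
      mul_div_cancel_left]
  rw [this]
  exact const_mem_polyMap le_rfl _

/-- The difference map is periodic of lower degree, hence a constant `c`; then `g n = g 0 * c ^ n`,
and the period forces `c ^ k = 1`. -/
theorem eq_of_periodic_of_mem_polyMap (htf : ∀ (t : Γ) (m : ℤ), m ≠ 0 → t ^ m = 1 → t = 1)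
    {D : ℕ} {g : ℤ → Γ} (hg : g ∈ polyMap D) {k : ℤ} (hk : k ≠ 0) (hper : ∀ n, g (n + k) = g n)
    (n : ℤ) : g n = g 0 := by
  induction D generalizing g n with
  | zero => rw [mem_polyMap_zero.1 hg]; rfl
  | succ D ih =>
    have hc := ih (hg 1) (fun n => by rw [add_right_comm, hper, hper])
    have hs : ∀ n, g (n + 1) = g n * (g (0 + 1) / g 0) := fun n => by
      rw [← hc n, mul_div_cancel]
    have hz := eq_zpow_of_forall_succ hs
    have h1 : g (0 + 1) / g 0 = 1 := by
      refine htf _ k hk ?_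
      have := hper 0
      rw [zero_add, hz k] at this
      simpa using this
    rw [hz n, h1, one_zpow, mul_one]

/-- Equal shifts make `g (n + (b - a)) / g n` constant, so the difference map is periodic, hence
constant. -/
theorem mem_polyMap_two_of_nshift_eq (htf : ∀ (t : Γ) (m : ℤ), m ≠ 0 → t ^ m = 1 → t = 1)
    {D : ℕ} {g : ℤ → Γ} (hg : g ∈ polyMap D) {a b : ℤ} (hab : a ≠ b)
    (h : nshift g a = nshift g b) : g ∈ polyMap 2 := by
  have hq : (fun n => g (n + 1) / g n) ∈ polyMap D := polyMap_le_succ D hg 1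
  have hd : ∀ n, g (n + (b - a)) = g n * (g b / g a) := fun n => by
    have := congrFun h (n - a)
    simp only [nshift, sub_add_cancel] at this
    rw [← add_sub_assoc, add_sub_right_comm, ← mul_div_assoc, mul_comm, mul_div_assoc, this,
      mul_div_cancel]
  have hc := eq_of_periodic_of_mem_polyMap htf hq (sub_ne_zero.2 hab.symm) (fun n => by
    rw [add_right_comm, hd, hd, mul_div_mul_right_eq_div])
  exact mem_polyMap_two_of_forall_succ (c := g (0 + 1) / g 0) fun n => by
    rw [← hc n, mul_div_cancel]

theorem zpow_mem_polyMap (t : Γ) {D : ℕ} {f : ℤ → ℤ} {P : Polynomial ℚ} (hP : P.degree < D)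
    (hf : ∀ n : ℤ, P.eval (n : ℚ) = f n) : (fun n => t ^ f n) ∈ polyMap D := by
  induction D generalizing f P with
  | zero =>
    rw [mem_polyMap_zero]
    have hP0 : P = 0 := by
      rw [← Polynomial.degree_eq_bot]
      simpa [Nat.WithBot.lt_zero_iff] using hP
    ext n
    have := hf n
    rw [hP0, Polynomial.eval_zero, eq_comm, Int.cast_eq_zero] at this
    simp [this]
  | succ D ih =>
    intro m
    have hE : ∀ n : ℤ, (Polynomial.taylor (m : ℚ) P - P).eval (n : ℚ) =
        ((f (n + m) - f n : ℤ) : ℚ) := fun n => by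
      rw [Polynomial.eval_sub, Polynomial.taylor_eval, hf n]
      have := hf (n + m)
      push_cast at this ⊢
      rw [← this]
    have := ih (P := Polynomial.taylor (m : ℚ) P - P) (f := fun n => f (n + m) - f n) ?_ hE
    · simpa only [zpow_sub, div_eq_mul_inv] using this
    · by_cases h0 : P = 0
      · simp [h0]
      have hlt := Polynomial.degree_sub_lt_left (p := Polynomial.taylor (m : ℚ) P) (q := P)
        (Polynomial.degree_taylor _ _) (by simpa using h0) (by simp)
      rw [Polynomial.degree_taylor] at hlt
      refine lt_of_lt_of_le hlt ?_
      rw [Polynomial.degree_eq_natDegree h0] at hP ⊢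
      exact_mod_cast Nat.lt_succ_iff.1 (by exact_mod_cast hP)

theorem polyExpr_mem_polyMap {d : ℕ} (T : Fin d → Γ) {q : Fin d → ℤ → ℤ}
    (hq : ∀ j, IsIntegralPolynomial (q j)) : ∃ D, polyExpr T q ∈ polyMap D := by
  choose P hP using hq
  refine ⟨Finset.univ.sup fun j => (P j).natDegree + 1, ?_⟩
  have : polyExpr T q = ∏ j, fun n => T j ^ q j n := by
    ext n; simp [polyExpr]
  rw [this]
  refine Subgroup.prod_mem _ fun j _ => ?_
  refine polyMap_mono (Finset.le_sup (f := fun j => (P j).natDegree + 1) (Finset.mem_univ j))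
    (zpow_mem_polyMap (T j) (P := P j) ?_ (hP j))
  exact lt_of_le_of_lt Polynomial.degree_le_natDegree (by exact_mod_cast Nat.lt_succ_self _)

end PolynomialMaps

/-! ### Idempotent ultrafilters and IP-sets. -/

section Ultrafilters

open Filter

/-- An idempotent ultrafilter on `ℤ`, other than the principal one at `0`: every large set `A`
has a large translate `A - m` for a large set of `m`, no singleton is large, and IP*-sets are. -/
structure IsIPUltrafilter (p : Ultrafilter ℤ) : Prop where
  eventually_add : ∀ A ∈ p, ∀ᶠ m in p, ∀ᶠ n in p, n + m ∈ A
  eventually_ne : ∀ c : ℤ, ∀ᶠ n in p, n ≠ c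
  mem_of_isIPStarSet : ∀ B : Set ℤ, IsIPStarSet B → B ∈ p

theorem exists_finset_sum_of_mem_FS {a : Stream' ℤ} {m : ℤ} (hm : m ∈ Hindman.FS a) :
    ∃ α : Finset ℕ, α.Nonempty ∧ m = ∑ i ∈ α, a.get i := by
  induction hm with
  | head' a => exact ⟨{0}, Finset.singleton_nonempty 0, by simp [Stream'.head]⟩
  | tail' a m _ ih =>
    obtain ⟨α, hα, rfl⟩ := ih
    exact ⟨α.map ⟨Nat.succ, Nat.succ_injective⟩, by simpa using hα, by simp [Stream'.get_tail]⟩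
  | cons' a m _ ih =>
    obtain ⟨α, hα, rfl⟩ := ih
    refine ⟨insert 0 (α.map ⟨Nat.succ, Nat.succ_injective⟩), Finset.insert_nonempty _ _, ?_⟩
    rw [Finset.sum_insert (by simp)]
    simp [Stream'.get_tail, Stream'.head]

attribute [local instance] Ultrafilter.add Ultrafilter.addSemigroup

theorem isIPUltrafilter_of_add_self {p : Ultrafilter ℤ} (hp : p + p = p)
    (h0 : ∀ᶠ n : ℤ in p, n ≠ 0) : IsIPUltrafilter p := by
  have hadd : ∀ P : ℤ → Prop, (∀ᶠ n in p, P n) ↔ ∀ᶠ m in p, ∀ᶠ n in p, P (m + n) := fun P => by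
    conv_lhs => rw [← hp]
    exact Ultrafilter.eventually_add p p P
  refine ⟨fun A hA => ?_, fun c => ?_, fun B hB => ?_⟩
  · simpa only [add_comm] using (hadd (· ∈ A)).1 hA
  · by_contra hc
    rw [← Ultrafilter.eventually_not] at hc
    simp only [not_not] at hc
    obtain ⟨m, ⟨rfl, hm0⟩, hm⟩ := ((hc.and h0).and ((hadd (· = c)).1 hc)).exists
    obtain ⟨n, rfl, hn⟩ := (hc.and hm).exists
    omega
  · by_contra hBp
    rw [← Ultrafilter.compl_mem_iff_notMem] at hBp
    -- Were `Bᶜ` large, it would contain an IP-set missed by `B`; removing `0` keeps the generators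
    -- non-zero.
    obtain ⟨a, ha⟩ := Hindman.exists_FS_of_large p hp (Bᶜ ∩ {n | n ≠ 0}) (inter_mem hBp h0)
    have ha0 : ∀ i, a.get i ≠ 0 := fun i => (ha (Hindman.FS.singleton a i)).2
    obtain ⟨_, hmB, α, hα, rfl⟩ := hB (FS a.get) ⟨a.get, by simp [ha0, Set.infinite_univ], rfl⟩
    exact (ha (Hindman.FS.finsetSum a α hα)).1 hmB

/-- With generators of one sign no finite sum vanishes, which keeps the ultrafilter from being
principal at `0`. -/
theorem exists_strictMono_of_infinite_ne_zero {s : ℕ → ℤ} (hs : {i | s i ≠ 0}.Infinite) :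
    ∃ φ : ℕ → ℕ, StrictMono φ ∧ ((∀ i, 0 < s (φ i)) ∨ ∀ i, s (φ i) < 0) := by
  have : {i | s i ≠ 0} = {i | 0 < s i} ∪ {i | s i < 0} := by
    ext i; simp [lt_or_lt_iff_ne, or_comm]
  rw [this, Set.infinite_union] at hs
  rcases hs with hs | hs
  · exact ⟨_, Nat.nth_strictMono hs, Or.inl (Nat.nth_mem_of_infinite hs)⟩
  · exact ⟨_, Nat.nth_strictMono hs, Or.inr (Nat.nth_mem_of_infinite hs)⟩

theorem IsIPSet.exists_isIPUltrafilter {A : Set ℤ} (hA : IsIPSet A) :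
    ∃ p : Ultrafilter ℤ, IsIPUltrafilter p ∧ A ∈ p := by
  obtain ⟨s, hs, rfl⟩ := hA
  obtain ⟨φ, hφ, hsign⟩ := exists_strictMono_of_infinite_ne_zero hs
  let a : Stream' ℤ := fun i => s (φ i)
  obtain ⟨p, hp, hpa⟩ := Hindman.exists_idempotent_ultrafilter_le_FS a
  refine ⟨p, isIPUltrafilter_of_add_self hp ?_, ?_⟩
  · refine hpa.mono fun m hm => ?_
    obtain ⟨α, hα, rfl⟩ := exists_finset_sum_of_mem_FS hm
    rcases hsign with h | h
    · exact (Finset.sum_pos (fun i _ => h i) hα).ne'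
    · exact (Finset.sum_neg (fun i _ => h i) hα).ne
  · refine hpa.mono fun m hm => ?_
    obtain ⟨α, hα, rfl⟩ := exists_finset_sum_of_mem_FS hm
    exact ⟨α.map ⟨φ, hφ.injective⟩, by simpa using hα, by simp [a, Stream'.get]⟩

theorem IsIPSet.nonempty {A : Set ℤ} (hA : IsIPSet A) : A.Nonempty := by
  obtain ⟨s, -, rfl⟩ := hA
  exact ⟨_, {0}, Finset.singleton_nonempty 0, rfl⟩

end Ultrafilters

/-! ### Torsion-freeness from mild mixing. -/

section MildMixing

theorem eq_one_of_zpow_eq_one {X Γ : Type*} [TopologicalSpace X] [T2Space X] [Nontrivial X]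
    [Group Γ] [MulAction Γ X] {t : Γ} (ht : t ≠ 1 → IsTopMildlyMixing X t) {m : ℤ} (hm : m ≠ 0)
    (h : t ^ m = 1) : t = 1 := by
  by_contra h1
  obtain ⟨x, y, hxy⟩ := exists_pair_ne X
  obtain ⟨U, V, hU, hV, hxU, hyV, hUV⟩ := t2_separation hxy
  -- The IP-set generated by the constant `m` consists of times at which `t` acts trivially.
  obtain ⟨_, ⟨z, hzU, hzV⟩, α, -, rfl⟩ :=
    ht h1 U V hU ⟨x, hxU⟩ hV ⟨y, hyV⟩ (FS fun _ => m) ⟨_, by simp [hm, Set.infinite_univ], rfl⟩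
  have hz : t ^ (∑ _i ∈ α, m) = 1 := by
    rw [Finset.sum_const, nsmul_eq_mul, mul_comm, zpow_mul, h, one_zpow]
  rw [Set.mem_preimage, hz, one_smul] at hzV
  exact Set.disjoint_left.1 hUV hzU hzV

end MildMixing

/-! ### The PET weight and its descent. -/

section Weight

variable {Γ : Type*} [CommGroup Γ]

/-- For each `d`, the members of `F` of exact degree `d` have at most `w d` leading terms: up to
maps of smaller degree, they agree with one of at most `w d` maps. -/
def HasWeight (F : Finset (ℤ → Γ)) {D : ℕ} (w : Fin D → ℕ) : Prop :=
  ∀ d : Fin D, ∃ C : Finset (ℤ → Γ), C.card ≤ w d ∧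
    ∀ g ∈ F, g ∈ polyMap (d + 1) → g ∉ polyMap d → ∃ c ∈ C, g / c ∈ polyMap d

theorem hasWeight_card (F : Finset (ℤ → Γ)) (D : ℕ) : HasWeight F (D := D) fun _ => F.card :=
  fun _ => ⟨F, le_rfl, fun g hg _ _ => ⟨g, hg, by rw [div_self']; exact one_mem _⟩⟩

open Classical in
/-- The finite family of all quotients by `φ` of the normalized translates of members of `F` by
`m t`, `t ∈ τ`, other than `φ` itself. -/
noncomputable def reduce {ι : Type*} (F : Finset (ℤ → Γ)) (τ : Finset ι) (m : ι → ℤ)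
    (φ : ℤ → Γ) : Finset (ℤ → Γ) :=
  (((F ×ˢ τ).image fun q => nshift q.1 (m q.2)).erase φ).image (· / φ)

theorem mem_reduce {ι : Type*} {F : Finset (ℤ → Γ)} {τ : Finset ι} {m : ι → ℤ} {φ q : ℤ → Γ} :
    q ∈ reduce F τ m φ ↔ ∃ g ∈ F, ∃ t ∈ τ, nshift g (m t) ≠ φ ∧ q = nshift g (m t) / φ := by
  classical
  simp only [reduce, Finset.mem_image, Finset.mem_erase, Finset.mem_product, Prod.exists]
  constructor
  · rintro ⟨h, ⟨hne, g, t, ⟨hg, ht⟩, rfl⟩, rfl⟩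
    exact ⟨g, hg, t, ht, hne, rfl⟩
  · rintro ⟨g, hg, t, ht, hne, rfl⟩
    exact ⟨_, ⟨hne, g, t, ⟨hg, ht⟩, rfl⟩, rfl⟩

/-- Shifting preserves leading terms. Dividing by `φ`, of degree `d₀`, leaves those of higher degree
alone, and in degree `d₀` it eliminates the class of `f`. Lower degrees may grow, which the
lexicographic order ignores. -/
theorem HasWeight.reduce {ι : Type*} {F : Finset (ℤ → Γ)} {D : ℕ} {w : Fin D → ℕ}
    (hw : HasWeight F w) (h0 : ∀ g ∈ F, g 0 = 1) {f : ℤ → Γ} (hf : f ∈ F) {d₀ : Fin D}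
    (hd₀ : 1 ≤ (d₀ : ℕ)) (hfd : f ∈ polyMap (d₀ + 1)) (hmin : ∀ g ∈ F, g ∉ polyMap d₀)
    (τ : Finset ι) (m : ι → ℤ) (t₀ : ι) :
    ∃ w' : Fin D → ℕ, Pi.Lex (· > ·) (· < ·) w' w ∧
      HasWeight (reduce F τ m (nshift f (m t₀))) w' := by
  classical
  set φ := nshift f (m t₀)
  obtain ⟨C₀, hC₀w, hC₀⟩ := hw d₀
  obtain ⟨c₀, hc₀, hfc₀⟩ := hC₀ f hf hfd (hmin f hf)
  have hφf : φ / f ∈ polyMap d₀ := nshift_div_mem hd₀ hfd _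
  have hφ : φ ∈ polyMap (d₀ + 1) := nshift_mem (by omega) hfd _
  have hpos : 0 < C₀.card := Finset.card_pos.2 ⟨c₀, hc₀⟩
  refine ⟨fun d => if d₀ < d then w d else if d = d₀ then C₀.card - 1 else
    (IPMild.reduce F τ m φ).card, ⟨d₀, fun d hd => if_pos hd, ?_⟩, fun d => ?_⟩
  · simp only [lt_irrefl, if_false, if_true]
    omega
  rcases lt_trichotomy d₀ d with hd | rfl | hd
  · obtain ⟨C, hCw, hC⟩ := hw d
    refine ⟨C, by simpa [hd] using hCw, fun q hq hq1 hq2 => ?_⟩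
    obtain ⟨g, hg, t, -, -, rfl⟩ := mem_reduce.1 hq
    have hdd : (d₀ : ℕ) < d := hd
    have hφd : φ ∈ polyMap d := polyMap_mono (by omega) hφ
    have hs : nshift g (m t) ∈ polyMap (d + 1) := by
      simpa using mul_mem hq1 (polyMap_le_succ _ hφd)
    have hg1 : g ∈ polyMap (d + 1) := mem_of_nshift_mem (by omega) (h0 g hg) hs
    have hg2 : g ∉ polyMap d := fun h => hq2 (div_mem (nshift_mem (by omega) h _) hφd)
    obtain ⟨c, hc, hgc⟩ := hC g hg hg1 hg2
    refine ⟨c, hc, ?_⟩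
    rw [div_right_comm, ← div_mul_div_cancel (nshift g (m t)) g c]
    exact div_mem (mul_mem (nshift_div_mem (by omega) hg1 _) hgc) hφd
  · refine ⟨(C₀.erase c₀).image (· / f), ?_, fun q hq hq1 hq2 => ?_⟩
    · simp only [lt_irrefl, if_false, if_true]
      exact Finset.card_image_le.trans (Finset.card_erase_of_mem hc₀).le
    obtain ⟨g, hg, t, -, -, rfl⟩ := mem_reduce.1 hq
    have hs : nshift g (m t) ∈ polyMap (d₀ + 1) := by simpa using mul_mem hq1 hφ
    have hg1 : g ∈ polyMap (d₀ + 1) := mem_of_nshift_mem (by omega) (h0 g hg) hs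
    obtain ⟨c, hc, hgc⟩ := hC₀ g hg hg1 (hmin g hg)
    have hhc : nshift g (m t) / c ∈ polyMap d₀ := by
      simpa using mul_mem (nshift_div_mem hd₀ hg1 (m t)) hgc
    have hfφ : f / φ ∈ polyMap d₀ := by simpa using inv_mem hφf
    have hcne : c ≠ c₀ := by
      rintro rfl
      refine hq2 ?_
      have := mul_mem (div_mem hhc hfc₀) hfφ
      rwa [div_div_div_cancel_right, div_mul_div_cancel] at this
    refine ⟨c / f, Finset.mem_image_of_mem _ (Finset.mem_erase.2 ⟨hcne, hc⟩), ?_⟩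
    rw [div_div_div_eq, mul_comm φ c, ← div_mul_div_comm]
    exact mul_mem hhc hfφ
  · refine ⟨IPMild.reduce F τ m φ, by simp [hd.not_gt, hd.ne], fun q hq _ _ => ⟨q, hq, ?_⟩⟩
    rw [div_self']
    exact one_mem _

end Weight

/-! ### Choice of the shifts. -/

section Recurrence

open Filter

variable {X Γ : Type*} [TopologicalSpace X] [CommGroup Γ] [MulAction Γ X] [ContinuousConstSMul Γ X]

theorem eventually_nshift_ne {p : Ultrafilter ℤ} (hp : IsIPUltrafilter p)
    (htf : ∀ (t : Γ) (m : ℤ), m ≠ 0 → t ^ m = 1 → t = 1) {D : ℕ} {g : ℤ → Γ}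
    (hg : g ∈ polyMap D) (hg2 : g ∉ polyMap 2) (φ : ℤ → Γ) : ∀ᶠ n in p, nshift g n ≠ φ := by
  by_cases h : ∃ a, nshift g a = φ
  · obtain ⟨a, rfl⟩ := h
    exact (hp.eventually_ne a).mono fun n hn h => hg2 (mem_polyMap_two_of_nshift_eq htf hg hn h)
  · exact Eventually.of_forall fun n hn => h ⟨n, hn⟩

theorem eventually_exists_zpow_smul_mem {p : Ultrafilter ℤ} (hp : IsIPUltrafilter p)
    (hmix : ∀ t : Γ, t ≠ 1 → IsTopMildlyMixing X t) {g : ℤ → Γ} (h0 : g 0 = 1) (h1 : g ≠ 1)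
    (hg2 : g ∈ polyMap 2) {U V : Set X} (hU : IsOpen U) (hUne : U.Nonempty) (hV : IsOpen V)
    (hVne : V.Nonempty) (t : Γ) : ∀ᶠ n in p, ∃ x ∈ U, (g n * t) • x ∈ V := by
  obtain ⟨c, hc⟩ := exists_eq_zpow_of_mem_polyMap_two hg2 h0
  have hc1 : c ≠ 1 := by
    rintro rfl
    exact h1 (funext fun n => by simp [hc])
  have hV' : ((fun x : X => t • x) ⁻¹' V).Nonempty :=
    hVne.preimage (MulAction.surjective t)
  refine mem_of_superset (hp.mem_of_isIPStarSet _
    (hmix c hc1 U _ hU hUne (hV.preimage (continuous_const_smul t)) hV')) ?_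
  rintro n ⟨x, hxU, hx⟩
  refine ⟨x, hxU, ?_⟩
  rwa [hc, mul_comm, mul_smul]

/-- The points that are moved into `V` by `g (m t) * t`. -/
def pullback (g : ℤ → Γ) (V : Set X) (a : ℤ) (t : Γ) : Set X := {x | (g a * t) • x ∈ V}

theorem isOpen_pullback (g : ℤ → Γ) {V : Set X} (hV : IsOpen V) (a : ℤ) (t : Γ) :
    IsOpen (pullback g V a t) := hV.preimage (continuous_const_smul _)

/-- The `m t` are chosen one `t` at a time, each new requirement holding for almost every value. -/
theorem exists_translates {p : Ultrafilter ℤ} (hp : IsIPUltrafilter p) [Nonempty X]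
    (hmix : ∀ t : Γ, t ≠ 1 → IsTopMildlyMixing X t)
    (htf : ∀ (t : Γ) (m : ℤ), m ≠ 0 → t ^ m = 1 → t = 1) {D : ℕ} {F : Finset (ℤ → Γ)}
    (h0 : ∀ g ∈ F, g 0 = 1) (h1 : ∀ g ∈ F, g ≠ 1) (hD : ∀ g ∈ F, g ∈ polyMap D)
    {V : (ℤ → Γ) → Set X} (hV : ∀ g ∈ F, IsOpen (V g)) (hVne : ∀ g ∈ F, (V g).Nonempty)
    {A : Set ℤ} (hA : A ∈ p) (τ : Finset Γ) :
    ∃ m : Γ → ℤ, (∀ t ∈ τ, ∀ᶠ n in p, n + m t ∈ A) ∧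
      (∀ g ∈ F, g ∉ polyMap 2 → ∀ g' ∈ F, ∀ t ∈ τ, ∀ t' ∈ τ, t ≠ t' →
        nshift g (m t) ≠ nshift g' (m t')) ∧
      ∀ g ∈ F, g ∈ polyMap 2 → (⋂ t ∈ τ, pullback g (V g) (m t) t).Nonempty := by
  classical
  induction τ using Finset.induction_on with
  | empty => exact ⟨0, by simp⟩
  | insert t τ ht ih =>
    obtain ⟨m, hmA, hmne, hmV⟩ := ih
    have e1 : ∀ᶠ a in p, ∀ g ∈ F, g ∈ polyMap 2 →
        ∃ x ∈ ⋂ t ∈ τ, pullback g (V g) (m t) t, (g a * t) • x ∈ V g := by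
      rw [eventually_all_finset]
      intro g hg
      rw [eventually_imp_distrib_left]
      intro hg2
      exact eventually_exists_zpow_smul_mem hp hmix (h0 g hg) (h1 g hg) hg2
        (isOpen_biInter_finset fun t _ => isOpen_pullback g (hV g hg) _ _) (hmV g hg hg2)
        (hV g hg) (hVne g hg) t
    have e2 : ∀ᶠ a in p, ∀ g ∈ F, ∀ g' ∈ F, ∀ t' ∈ τ, g ∉ polyMap 2 →
        nshift g a ≠ nshift g' (m t') := by
      simp only [eventually_all_finset, eventually_imp_distrib_left]
      exact fun g hg g' _ t' _ hg2 => eventually_nshift_ne hp htf (hD g hg) hg2 _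
    obtain ⟨a, ⟨haA, haV⟩, hane⟩ := (((hp.eventually_add A hA).and e1).and e2).exists
    have hup : ∀ t' ∈ τ, Function.update m t a t' = m t' := fun t' ht' =>
      Function.update_of_ne (ne_of_mem_of_not_mem ht' ht) _ _
    refine ⟨Function.update m t a, fun t' ht' => ?_, fun g hg hg2 g' hg' t₁ ht₁ t₂ ht₂ hne => ?_,
      fun g hg hg2 => ?_⟩
    · rcases Finset.mem_insert.1 ht' with rfl | ht'
      · rwa [Function.update_self]
      · rw [hup t' ht']; exact hmA t' ht'
    · rcases Finset.mem_insert.1 ht₁ with rfl | h₁ <;> rcases Finset.mem_insert.1 ht₂ with rfl | h₂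
      · exact (hne rfl).elim
      · rw [Function.update_self, hup _ h₂]
        exact hane g hg g' hg' t₂ h₂ hg2
      · rw [Function.update_self, hup _ h₁]
        by_cases hg'2 : g' ∈ polyMap 2
        · rw [nshift_eq_self hg'2 (h0 g' hg')]
          rintro rfl
          exact hg2 (mem_of_nshift_mem one_le_two (h0 g hg) hg'2)
        · exact (hane g' hg' g hg t₁ h₁ hg'2).symm
      · rw [hup _ h₁, hup _ h₂]
        exact hmne g hg hg2 g' hg' t₁ h₁ t₂ h₂ hne
    · obtain ⟨x, hx, hxV⟩ := haV g hg hg2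
      refine ⟨x, ?_⟩
      rw [Finset.set_biInter_insert]
      refine ⟨by rwa [Function.update_self], ?_⟩
      simp only [Set.mem_iInter] at hx ⊢
      intro t' ht'
      rw [hup t' ht']
      exact hx t' ht'

end Recurrence

/-! ### The PET induction. -/

section Recurrence

variable {X Γ : Type*} [TopologicalSpace X] [CompactSpace X] [CommGroup Γ] [MulAction Γ X]
  [ContinuousConstSMul Γ X] [MulAction.IsMinimal Γ X]

theorem exists_mem_of_hasWeight {p : Ultrafilter ℤ} (hp : IsIPUltrafilter p)
    (hmix : ∀ t : Γ, t ≠ 1 → IsTopMildlyMixing X t)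
    (htf : ∀ (t : Γ) (m : ℤ), m ≠ 0 → t ^ m = 1 → t = 1) {D : ℕ} (w : Fin D → ℕ)
    {F : Finset (ℤ → Γ)} (hw : HasWeight F w) (h0 : ∀ g ∈ F, g 0 = 1) (h1 : ∀ g ∈ F, g ≠ 1)
    (hD : ∀ g ∈ F, g ∈ polyMap D) {U : Set X} {V : (ℤ → Γ) → Set X} (hU : IsOpen U)
    (hUne : U.Nonempty) (hV : ∀ g ∈ F, IsOpen (V g)) (hVne : ∀ g ∈ F, (V g).Nonempty)
    {A : Set ℤ} (hA : A ∈ p) : ∃ n ∈ A, ∃ x ∈ U, ∀ g ∈ F, g n • x ∈ V g := by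
  classical
  have hwf : WellFounded (Pi.Lex (· > ·) (fun {_ : Fin D} => ((· < ·) : ℕ → ℕ → Prop))) :=
    Pi.Lex.wellFounded _ fun _ => wellFounded_lt
  induction w using hwf.induction generalizing F U V A with
  | _ w ih =>
  rcases F.eq_empty_or_nonempty with rfl | hF
  · obtain ⟨n, hn⟩ := p.nonempty_of_mem hA
    obtain ⟨x, hx⟩ := hUne
    exact ⟨n, hn, x, hx, by simp⟩
  have : Nonempty X := ⟨hUne.some⟩
  obtain ⟨f, hf, d₀, hd₀, hfd, hmin⟩ : ∃ f ∈ F, ∃ d₀ : Fin D, 1 ≤ (d₀ : ℕ) ∧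
      f ∈ polyMap (d₀ + 1) ∧ ∀ g ∈ F, g ∉ polyMap d₀ := by
    have hex : ∃ d, ∃ f ∈ F, f ∈ polyMap d := ⟨D, hF.choose, hF.choose_spec, hD _ hF.choose_spec⟩
    obtain ⟨f, hf, hfd⟩ := Nat.find_spec hex
    have hle : Nat.find hex ≤ D := Nat.find_min' hex ⟨f, hf, hD f hf⟩
    -- Otherwise the map is constant, hence `1` by normalization.
    have h2 : 2 ≤ Nat.find hex := by
      by_contra hlt
      have hf1 : f ∈ polyMap 1 := polyMap_mono (by omega) hfd
      exact h1 f hf (funext fun n => by rw [eq_of_mem_polyMap_one hf1, h0 f hf]; rfl)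
    refine ⟨f, hf, ⟨Nat.find hex - 1, by omega⟩, by simp only; omega, ?_, fun g hg hgd => ?_⟩
    · rwa [Nat.sub_add_cancel (by omega)]
    · exact Nat.find_min hex (Nat.sub_one_lt (by omega)) ⟨g, hg, hgd⟩
  obtain ⟨τ, hτ⟩ : ∃ τ : Finset Γ, ∀ y : X, ∃ t ∈ τ, t • y ∈ U := by
    obtain ⟨I, hI⟩ := isCompact_univ.exists_finite_cover_smul Γ hU hUne
    refine ⟨I.image (·⁻¹), fun y => ?_⟩
    obtain ⟨t, ht, hy⟩ := Set.mem_iUnion₂.1 (hI (Set.mem_univ y))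
    exact ⟨t⁻¹, Finset.mem_image_of_mem _ ht, Set.mem_smul_set_iff_inv_smul_mem.1 hy⟩
  obtain ⟨t₀, ht₀, -⟩ := hτ hUne.some
  obtain ⟨m, hmA, hmne, hmV⟩ := exists_translates hp hmix htf h0 h1 hD hV hVne hA τ
  obtain ⟨w', hw', hred⟩ := hw.reduce h0 hf hd₀ hfd hmin τ m t₀
  set φ := nshift f (m t₀) with hφ
  -- Distinct pairs `(g, t)` may give the same shift `h`, which must then meet all their targets.
  let W : (ℤ → Γ) → Set X := fun h =>
    ⋂ q ∈ (F ×ˢ τ).filter (fun q => nshift q.1 (m q.2) = h), pullback q.1 (V q.1) (m q.2) q.2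
  have hWopen : ∀ h, IsOpen (W h) := fun h => isOpen_biInter_finset fun q hq =>
    isOpen_pullback _ (hV _ (Finset.mem_product.1 (Finset.mem_filter.1 hq).1).1) _ _
  have hWmem : ∀ g ∈ F, ∀ t ∈ τ, W (nshift g (m t)) ⊆ pullback g (V g) (m t) t := by
    intro g hg t ht x hx
    exact Set.mem_iInter₂.1 hx (g, t) (by simp [hg, ht])
  have hWne : ∀ g ∈ F, ∀ t ∈ τ, (W (nshift g (m t))).Nonempty := by
    intro g hg t ht
    by_cases hg2 : g ∈ polyMap 2
    · obtain ⟨x, hx⟩ := hmV g hg hg2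
      refine ⟨x, Set.mem_iInter₂.2 ?_⟩
      rintro ⟨g', t'⟩ hq
      simp only [Finset.mem_filter, Finset.mem_product] at hq ⊢
      obtain ⟨⟨hg', ht'⟩, he⟩ := hq
      rw [nshift_eq_self hg2 (h0 g hg)] at he
      have hg'2 : g' ∈ polyMap 2 := mem_of_nshift_mem one_le_two (h0 g' hg') (he ▸ hg2)
      rw [nshift_eq_self hg'2 (h0 g' hg')] at he
      subst he
      exact Set.mem_iInter₂.1 hx t' ht'
    · obtain ⟨x, hx⟩ := (hVne g hg).preimage (MulAction.surjective (α := Γ) (β := X) (g (m t) * t))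
      refine ⟨x, Set.mem_iInter₂.2 ?_⟩
      rintro ⟨g', t'⟩ hq
      simp only [Finset.mem_filter, Finset.mem_product] at hq ⊢
      obtain ⟨⟨hg', ht'⟩, he⟩ := hq
      have htt : t = t' := by
        by_contra hne
        exact hmne g hg hg2 g' hg' t ht t' ht' hne he.symm
      subst htt
      have hgg : g' = g := by
        rw [← nshift_nshift (h0 g' hg') (m t), he, nshift_nshift (h0 g hg)]
      subst hgg
      exact hx
  have hφD : φ ∈ polyMap D := nshift_mem (by omega) (hD f hf) _
  obtain ⟨n, hnA, z, hz, hzV⟩ := ih w' hw' hred (U := W φ) (V := fun q => W (q * φ))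
    (A := A ∩ ⋂ t ∈ τ, {n | n + m t ∈ A})
    (fun q hq => by
      obtain ⟨g, -, t, -, -, rfl⟩ := mem_reduce.1 hq
      simp [hφ, nshift_zero])
    (fun q hq => by
      obtain ⟨g, -, t, -, hne, rfl⟩ := mem_reduce.1 hq
      exact div_ne_one.2 hne)
    (fun q hq => by
      obtain ⟨g, hg, t, -, -, rfl⟩ := mem_reduce.1 hq
      exact div_mem (nshift_mem (by omega) (hD g hg) _) hφD)
    (hWopen φ) (hWne f hf t₀ ht₀) (fun q _ => hWopen _)
    (fun q hq => by
      obtain ⟨g, hg, t, ht, -, rfl⟩ := mem_reduce.1 hq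
      simpa using hWne g hg t ht)
    (Filter.inter_mem hA ((Filter.biInter_finset_mem τ).2 hmA))
  -- All `t ∈ τ` work for the targets, so `t` can be chosen after `n` and `z`.
  obtain ⟨t, ht, htU⟩ := hτ ((φ n)⁻¹ • z)
  refine ⟨n + m t, Set.mem_iInter₂.1 hnA.2 t ht, _, htU, fun g hg => ?_⟩
  have key : (nshift g (m t) n * (φ n)⁻¹) • z ∈ W (nshift g (m t)) := by
    by_cases hne : nshift g (m t) = φ
    · simpa [hne] using hz
    · simpa [div_eq_mul_inv] using hzV _ (mem_reduce.2 ⟨g, hg, t, ht, hne, rfl⟩)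
  have hgz : (g (m t) * t) • (nshift g (m t) n * (φ n)⁻¹) • z ∈ V g := hWmem g hg t ht key
  have he : g (n + m t) • t • (φ n)⁻¹ • z =
      (g (m t) * t) • (nshift g (m t) n * (φ n)⁻¹) • z := by
    simp only [smul_smul, nshift]
    congr 1
    rw [mul_comm (g (m t)) t, mul_assoc t, ← mul_assoc (g (m t)), mul_div_cancel,
      mul_left_comm]
  rwa [he]

/-- Topological mild mixing of all orders along polynomials: the set of times `n` at which `U`
meets all the sets `g i n ⁻¹ V i` is large. -/
theorem exists_mem_of_polyMap {p : Ultrafilter ℤ} (hp : IsIPUltrafilter p)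
    (hmix : ∀ t : Γ, t ≠ 1 → IsTopMildlyMixing X t)
    (htf : ∀ (t : Γ) (m : ℤ), m ≠ 0 → t ^ m = 1 → t = 1) {ι : Type*} [Fintype ι] {D : ℕ}
    {g : ι → ℤ → Γ} (hD : ∀ i, g i ∈ polyMap D) (hg : ∀ i, DependsNontrivially (g i))
    (hgg : ∀ i j, i ≠ j → DependsNontrivially fun n => g i n * (g j n)⁻¹) {U : Set X}
    (hU : IsOpen U) (hUne : U.Nonempty) {V : ι → Set X} (hV : ∀ i, IsOpen (V i))
    (hVne : ∀ i, (V i).Nonempty) {A : Set ℤ} (hA : A ∈ p) :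
    ∃ n ∈ A, ∃ x ∈ U, ∀ i, g i n • x ∈ V i := by
  classical
  have hinj : Function.Injective fun i => nshift (g i) 0 := by
    intro i j hij
    by_contra hne
    obtain ⟨a, b, hab⟩ := hgg i j hne
    refine hab ?_
    have h : ∀ n, g i n * (g j n)⁻¹ = g i 0 * (g j 0)⁻¹ := fun n => by
      have := congrFun hij n
      simp only [nshift, add_zero] at this
      rw [← div_eq_mul_inv, ← div_eq_mul_inv, div_eq_div_iff_mul_eq_mul]
      rwa [div_eq_div_iff_mul_eq_mul, mul_comm (g j n)] at this
    simp only [h]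
  -- The constants `g i 0` are absorbed into the targets; the value `∅` off the family is never
  -- used.
  let V' : (ℤ → Γ) → Set X := Function.extend (fun i => nshift (g i) 0)
    (fun i => (fun x : X => g i 0 • x) ⁻¹' V i) fun _ => ∅
  have hV' : ∀ i, V' (nshift (g i) 0) = (fun x : X => g i 0 • x) ⁻¹' V i := hinj.extend_apply _ _
  obtain ⟨n, hn, x, hx, hxV⟩ := exists_mem_of_hasWeight hp hmix htf (D := D + 1) _
    (hasWeight_card (Finset.univ.image fun i => nshift (g i) 0) (D + 1)) (U := U) (V := V')
    (by simp [nshift_zero])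
    (by
      simp only [Finset.mem_image, Finset.mem_univ, true_and, forall_exists_index,
        forall_apply_eq_imp_iff]
      intro i h
      obtain ⟨a, b, hab⟩ := hg i
      refine hab ?_
      have h' : ∀ n, g i n = g i 0 := fun n => by
        simpa [nshift, div_eq_one] using congrFun h n
      rw [h' a, h' b])
    (by
      simp only [Finset.mem_image, Finset.mem_univ, true_and, forall_exists_index,
        forall_apply_eq_imp_iff]
      exact fun i => nshift_mem (by omega) (polyMap_le_succ D (hD i)) 0)
    hU hUne
    (by
      simp only [Finset.mem_image, Finset.mem_univ, true_and, forall_exists_index,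
        forall_apply_eq_imp_iff, hV']
      exact fun i => (hV i).preimage (continuous_const_smul _))
    (by
      simp only [Finset.mem_image, Finset.mem_univ, true_and, forall_exists_index,
        forall_apply_eq_imp_iff, hV']
      exact fun i => (hVne i).preimage (MulAction.surjective _))
    hA
  refine ⟨n, hn, x, hx, fun i => ?_⟩
  have := hxV _ (Finset.mem_image_of_mem _ (Finset.mem_univ i))
  rw [hV'] at this
  simpa [nshift, smul_smul] using this

end Recurrence

/-- Baire category: if all the transfer conditions between open sets can be met at times in `A`,
then the orbits of generic points along `A` are dense. -/
theorem exists_isGδ_dense_of_transfer {X Γ ι : Type*} [TopologicalSpace X]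
    [SecondCountableTopology X] [BaireSpace X] [Group Γ] [MulAction Γ X]
    [ContinuousConstSMul Γ X] [Finite ι] (g : ι → ℤ → Γ) (A : Set ℤ)
    (h : ∀ U : Set X, IsOpen U → U.Nonempty → ∀ V : ι → Set X, (∀ i, IsOpen (V i)) →
      (∀ i, (V i).Nonempty) → ∃ n ∈ A, ∃ x ∈ U, ∀ i, g i n • x ∈ V i) :
    ∃ X₀ : Set X, IsGδ X₀ ∧ Dense X₀ ∧
      ∀ x ∈ X₀, Dense {y : ι → X | ∃ n ∈ A, y = fun i => g i n • x} := by
  let B := TopologicalSpace.countableBasis X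
  have hB := TopologicalSpace.isBasis_countableBasis X
  let O : (ι → B) → Set X := fun V => ⋃ n ∈ A, ⋂ i, (fun x => g i n • x) ⁻¹' (V i : Set X)
  have : Countable B := (TopologicalSpace.countable_countableBasis X).to_subtype
  have hO : ∀ V, IsOpen (O V) := fun V => isOpen_biUnion fun n _ => isOpen_iInter_of_finite
    fun i => (hB.isOpen (V i).2).preimage (continuous_const_smul _)
  refine ⟨⋂ V, O V, IsGδ.iInter_of_isOpen hO, dense_iInter_of_isOpen hO fun V => ?_,
    fun x hx => ?_⟩
  · rw [dense_iff_inter_open]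
    intro U hU hUne
    obtain ⟨n, hn, x, hxU, hx⟩ := h U hU hUne (fun i => V i) (fun i => hB.isOpen (V i).2)
      fun i => TopologicalSpace.nonempty_of_mem_countableBasis (V i).2
    exact ⟨x, hxU, Set.mem_biUnion hn (Set.mem_iInter.2 hx)⟩
  · rw [dense_iff_inter_open]
    rintro W hW ⟨y, hy⟩
    obtain ⟨S, hS, hSW⟩ := isOpen_pi_iff'.1 hW y hy
    choose V hVB hyV hVS using fun i => hB.exists_subset_of_mem_open (hS i).2 (hS i).1
    obtain ⟨n, hn, hxn⟩ := Set.mem_iUnion₂.1 (Set.mem_iInter.1 hx fun i => ⟨V i, hVB i⟩)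
    exact ⟨fun i => g i n • x, hSW fun i _ => hVS i (Set.mem_iInter.1 hxn i), n, hn, rfl⟩

end IPMild

theorem corollary1p7 {X Γ : Type*} [MetricSpace X] [CompactSpace X] [CommGroup Γ]
    [MulAction Γ X] [ContinuousConstSMul Γ X] (hmin : MulAction.IsMinimal Γ X)
    (hmix : ∀ t : Γ, t ≠ 1 → IPMild.IsMildlyMixingMinimal X t)
    (d k : ℕ) (T : Fin d → Γ) (p : Fin k → Fin d → ℤ → ℤ)
    (hp : ∀ i j, IPMild.IsIntegralPolynomial (p i j))
    (hg : ∀ i, IPMild.DependsNontrivially (IPMild.polyExpr T (p i)))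
    (hgg : ∀ i j, i ≠ j → IPMild.DependsNontrivially
      (fun n => IPMild.polyExpr T (p i) n * (IPMild.polyExpr T (p j) n)⁻¹))
    (A : Set ℤ) (hA : IPMild.IsIPSet A) :
    ∃ X₀ : Set X, IsGδ X₀ ∧ Dense X₀ ∧ ∀ x ∈ X₀,
      Dense {y : Fin k → X | ∃ n ∈ A, y = fun i => IPMild.polyExpr T (p i) n • x} := by
  -- Torsion-freeness of `Γ` needs two points to separate.
  rcases subsingleton_or_nontrivial X with hX | hX
  · obtain ⟨n, hn⟩ := hA.nonempty
    refine ⟨Set.univ, IsGδ.univ, dense_univ, fun x _ y => subset_closure ?_⟩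
    exact ⟨n, hn, Subsingleton.elim _ _⟩
  obtain ⟨u, hu, hAu⟩ := hA.exists_isIPUltrafilter
  choose D hD using fun i => IPMild.polyExpr_mem_polyMap T (hp i)
  refine IPMild.exists_isGδ_dense_of_transfer (fun i => IPMild.polyExpr T (p i)) A
    fun U hU hUne V hV hVne => ?_
  exact IPMild.exists_mem_of_polyMap hu (fun t ht => (hmix t ht).2)
    (fun t m hm h => IPMild.eq_one_of_zpow_eq_one (X := X) (fun ht => (hmix t ht).2) hm h)
    (D := Finset.univ.sup D)
    (fun i => IPMild.polyMap_mono (Finset.le_sup (Finset.mem_univ i)) (hD i))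
    hg hgg hU hUne hV hVne hAu
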